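/- Consider $n\ge 2$ nodes, each of which is \texttt{Alpha}-colored, \texttt{Beta}-colored or undecided. A configuration $\mathbf{x}=(a,b,q)$ records the numbers $a,b,q$ of \texttt{Alpha}, \texttt{Beta} and undecided nodes ($a+b+q=n$); its bias is $s(\mathbf{x})=a-b\in\mathbb{Z}$. In the U-Process, in each synchronous round every node independently picks one of the $n$ nodes (possibly itself) uniformly at random; an undecided node takes over the state of the picked node, a colored node that picks a node of the other color becomes undecided, and in all other cases a node keeps its state. Let $p_{\mathbf{x},\mathbf{y}}$ be the resulting transition probabilities. For a bias threshold $m>0$ (such as $m=\gamma\sqrt{n\log n}$ with a constant $\gamma>0$) let $$H_2=\{\mathbf{x}: \tfrac{n}{18}\le q(\mathbf{x})\le \tfrac n2,\ |s(\mathbf{x})|<m\},\qquad H_4=\{\mathbf{x}: q(\mathbf{x})\ge \tfrac{n}{18},\ m\le |s(\mathbf{x})|<\tfrac23 n\}.$$ For an integer $\bar s$ with $|\bar s|\le n$ let $\mathbf{z}(\bar s)$ be the configuration of bias $\bar s$ with exactly $n/2$ undecided nodes if it exists, and otherwise (when parity or $|\bar s|>n/2$ excludes it) the configuration of bias $\bar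 s$ whose number of undecided nodes is the largest possible number not exceeding $n/2$. The U-Pruned-Process is the Markov chain that moves like the U-Process, except that from a configuration $\mathbf{x}\in H_2$ every transition to a configuration $\mathbf{y}$ with $q(\mathbf{y})<\frac n{18}$ or $q(\mathbf{y})>\frac n2$ is redirected to $\mathbf{z}(s(\mathbf{y}))$; that is, $p'_{\mathbf{x},\mathbf{y}}$ is the probability that one arrives at $\mathbf{y}$ by drawing from $p_{\mathbf{x},\cdot}$ and then applying this redirection. \textbf{Corollary.} For all constants $\kappa>0$ and $\beta>0$ there are constants $C>0$ and $N$ such that for every $n\ge N$, every threshold $0<m\le\kappa\sqrt n\log n$ and every initial configuration $\mathbf{x}\in H_2$, the U-Pruned-Process started at $\mathbf{x}$ reaches a configuration in $H_4$ within $\lfloor C\log n\rfloor$ rounds with probability at least $1-n^{-\beta}$. -/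

import Mathlib

namespace UndecidedState

/-- The three possible states of a node. -/
inductive Opinion where
  | alpha : Opinion
  | beta : Opinion
  | undecided : Opinion

/-- Update rule: an undecided node copies the opinion it sees; a coloured node becomes undecided
if it sees the other colour, and otherwise keeps its colour. -/
def Opinion.update : Opinion → Opinion → Opinion
  | .undecided, o => o
  | .alpha, .beta => .undecided
  | .alpha, _ => .alpha
  | .beta, .alpha => .undecided
  | .beta, _ => .beta

/-- A configuration of `n` nodes: the numbers of `alpha`, `beta` and undecided nodes. -/
@[ext] structure Config (n : ℕ) where
  a : ℕ
  b : ℕ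
  q : ℕ
  sum_eq : a + b + q = n

variable {n : ℕ}

/-- The bias `s = a - b`. -/
def Config.bias (x : Config n) : ℤ := (x.a : ℤ) - (x.b : ℤ)

/-- The nodes of a system in configuration `x`. -/
abbrev Config.Node (x : Config n) : Type := Fin x.a ⊕ Fin x.b ⊕ Fin x.q

/-- The opinion of each node of a system in configuration `x`. -/
def Config.opinion (x : Config n) : x.Node → Opinion
  | .inl _ => .alpha
  | .inr (.inl _) => .beta
  | .inr (.inr _) => .undecided

/-- The opinion of node `u` after a round in which every node `v` looks at node `g v`. -/
def Config.newOpinion (x : Config n) (g : x.Node → x.Node) (u : x.Node) : Opinion :=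
  (x.opinion u).update (x.opinion (g u))

theorem card_opinion_add {V : Type} [Fintype V] (f : V → Opinion) :
    Nat.card {u : V // f u = .alpha} + Nat.card {u : V // f u = .beta}
      + Nat.card {u : V // f u = .undecided} = Fintype.card V := by
  classical
  simp only [Nat.card_eq_fintype_card, Fintype.card_subtype]
  rw [← Finset.card_union_of_disjoint, ← Finset.card_union_of_disjoint, ← Finset.card_univ]
  · congr 1
    ext u
    cases h : f u <;> simp [h]
  · rw [Finset.disjoint_left]
    intro u
    cases h : f u <;> simp [h]
  · rw [Finset.disjoint_left]
    intro u
    cases h : f u <;> simp [h]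

/-- The configuration after a round in which every node `v` looks at node `g v`. -/
noncomputable def Config.next (x : Config n) (g : x.Node → x.Node) : Config n where
  a := Nat.card {u : x.Node // x.newOpinion g u = .alpha}
  b := Nat.card {u : x.Node // x.newOpinion g u = .beta}
  q := Nat.card {u : x.Node // x.newOpinion g u = .undecided}
  sum_eq := by
    rw [card_opinion_add]
    simp only [Fintype.card_sum, Fintype.card_fin]
    have := x.sum_eq
    omega

instance (x : Config n) : Nonempty (x.Node → x.Node) := ⟨id⟩

/-- One round of the U-Process: all nodes, simultaneously and independently, look at a node
chosen uniformly at random among all `n` nodes. -/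
noncomputable def uStep (x : Config n) : PMF (Config n) :=
  (PMF.uniformOfFintype (x.Node → x.Node)).map x.next

/-- The number of undecided nodes lies in `[n/18, n/2]`. -/
def Config.InRange (x : Config n) : Prop := (n : ℝ) / 18 ≤ x.q ∧ (x.q : ℝ) ≤ (n : ℝ) / 2

/-- The region `H₂` with bias threshold `m`. -/
def H2 (n : ℕ) (m : ℝ) : Set (Config n) := {x | x.InRange ∧ |(x.bias : ℝ)| < m}

/-- The region `H₄` with bias threshold `m`. -/
def H4 (n : ℕ) (m : ℝ) : Set (Config n) :=
  {x | (n : ℝ) / 18 ≤ x.q ∧ m ≤ |(x.bias : ℝ)| ∧ |(x.bias : ℝ)| < 2 / 3 * (n : ℝ)}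

theorem Config.natAbs_bias_le (x : Config n) : x.bias.natAbs ≤ n := by
  have := x.sum_eq
  unfold Config.bias
  omega

/-- The number of nodes of the minority colour in `zConfig n s`. -/
def zMinority (n : ℕ) (s : ℤ) : ℕ :=
  min ((n - s.natAbs - n / 2 + 1) / 2) ((n - s.natAbs) / 2)

/-- The configuration `z(s)` of bias `s` with `n/2` undecided nodes; when there is none (for
reasons of parity, or because `|s| > n/2`), the one of bias `s` whose number of undecided nodes
is the largest possible number not exceeding `n/2`. The three facts below say that this is what
the formula gives. -/
def zConfig (n : ℕ) (s : ℤ) (hs : s.natAbs ≤ n) : Config n where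
  a := zMinority n s + s.toNat
  b := zMinority n s + (-s).toNat
  q := n - s.natAbs - 2 * zMinority n s
  sum_eq := by
    have : 2 * zMinority n s ≤ n - s.natAbs := by
      unfold zMinority
      omega
    omega

theorem zConfig_bias (s : ℤ) (hs : s.natAbs ≤ n) : (zConfig n s hs).bias = s := by
  simp only [Config.bias, zConfig]
  omega

theorem zConfig_q_le (hn : 2 ≤ n) (s : ℤ) (hs : s.natAbs ≤ n) :
    2 * (zConfig n s hs).q ≤ n := by
  simp only [zConfig, zMinority]
  omega

theorem le_zConfig_q (s : ℤ) (hs : s.natAbs ≤ n) (y : Config n) (hy : y.bias = s)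
    (hq : 2 * y.q ≤ n) : y.q ≤ (zConfig n s hs).q := by
  have := y.sum_eq
  simp only [zConfig, zMinority]
  unfold Config.bias at hy
  omega

open Classical in
/-- Replace a configuration `y` whose number of undecided nodes is outside `[n/18, n/2]`
by `z(s(y))`. -/
noncomputable def redirect (y : Config n) : Config n :=
  if y.InRange then y else zConfig n y.bias y.natAbs_bias_le

open Classical in
/-- One round of the U-Pruned-Process: from `H₂` the transitions that leave the undecided range
are redirected; from every other configuration it is a round of the U-Process. -/
noncomputable def prunedStep (m : ℝ) (x : Config n) : PMF (Config n) :=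
  if x ∈ H2 n m then (uStep x).map redirect else uStep x

/-- The joint law of `(X₀, …, X_T)` for the Markov chain with transition probabilities `P`
started at `X₀ = x`. -/
noncomputable def pathLaw {S : Type} (P : S → PMF S) (x : S) :
    (T : ℕ) → PMF (Fin (T + 1) → S)
  | 0 => PMF.pure fun _ => x
  | T + 1 => (pathLaw P x T).bind fun w =>
      (P (w (Fin.last T))).map fun y => Fin.snoc (α := fun _ => S) w y

/-- The probability that the Markov chain with transition probabilities `P`, started at `x`,
visits `A` within `T` rounds. -/
noncomputable def hitProb {S : Type} (P : S → PMF S) (x : S) (A : Set S) (T : ℕ) : ℝ :=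
  ((pathLaw P x T).toOuterMeasure {w | ∃ t, w t ∈ A}).toReal

end UndecidedState

/-! ### Expectations along paths of a Markov chain, and escape from a set. -/

namespace UndecidedState

/-! The proof uses the potential exp(-rate·|s|/√n), which contracts in expectation by the constant
factor exp(-4·rate²) in each round started in `H2` (`Config.mean_potential_le`). Redirection
preserves the bias, so the pruned chain inherits the contraction. On `H2` the potential is at least
exp(-rate·m/√n), a power of 1/n for the thresholds allowed, so by Markov's inequality the chain
survives C log n rounds inside `H2` only with polynomially small probability. It can leave `H2`
other than into `H4` only by a jump to bias at least 2n/3, which is exponentially unlikely.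

The contraction has two regimes. For |s| above a small multiple of √n, the drift s(1 + q/n) with q ≥
n/18 beats the fluctuations, measured by the moment generating function (`Config.mean_exp_le`). For
smaller |s|, fluctuations of order √n do the work: the characteristic function at frequency 1/√n is
bounded away from 1 (`Config.mean_cos_le`), so the bias does not concentrate near 0. Here the gain
is linear in the rate and the required loss quadratic, so a small rate suffices. -/

/-- The expectation of `f` under `p`. -/
noncomputable def expect {S : Type} (p : PMF S) (f : S → ENNReal) : ENNReal := ∑' a, p a * f a

theorem expect_bind {S R : Type} (p : PMF S) (k : S → PMF R) (f : R → ENNReal) :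
    expect (p.bind k) f = expect p fun a => expect (k a) f := by
  simp only [expect, PMF.bind_apply, ← ENNReal.tsum_mul_right, ← ENNReal.tsum_mul_left]
  rw [ENNReal.tsum_comm]
  simp only [mul_assoc]

theorem expect_pure {S : Type} (a : S) (f : S → ENNReal) : expect (PMF.pure a) f = f a := by
  classical
  simp only [expect, PMF.pure_apply]
  rw [tsum_eq_single a]
  · simp
  · intro b hb
    simp [hb]

theorem expect_map {S R : Type} (p : PMF S) (k : S → R) (f : R → ENNReal) :
    expect (p.map k) f = expect p fun a => f (k a) := by
  rw [← PMF.bind_pure_comp, expect_bind]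
  simp [expect_pure]

theorem expect_mono {S : Type} (p : PMF S) {f g : S → ENNReal} (h : ∀ a, f a ≤ g a) :
    expect p f ≤ expect p g :=
  ENNReal.tsum_le_tsum fun a => mul_le_mul_right (h a) _

theorem expect_const {S : Type} (p : PMF S) (c : ENNReal) : expect p (fun _ => c) = c := by
  simp [expect, ENNReal.tsum_mul_right]

theorem expect_add {S : Type} (p : PMF S) (f g : S → ENNReal) :
    expect p (fun a => f a + g a) = expect p f + expect p g := by
  simp [expect, mul_add, ENNReal.tsum_add]

theorem expect_const_mul {S : Type} (p : PMF S) (c : ENNReal) (f : S → ENNReal) :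
    expect p (fun a => c * f a) = c * expect p f := by
  simp only [expect, ← ENNReal.tsum_mul_left]
  congr 1
  ext a
  ring

theorem toOuterMeasure_eq_expect {S : Type} (p : PMF S) (A : Set S) :
    p.toOuterMeasure A = expect p (A.indicator fun _ => 1) := by
  rw [PMF.toOuterMeasure_apply, expect]
  congr 1
  ext a
  by_cases h : a ∈ A <;> simp [h]

theorem expect_pathLaw_succ {S : Type} (P : S → PMF S) (x : S) (T : ℕ)
    (f : (Fin (T + 2) → S) → ENNReal) :
    expect (pathLaw P x (T + 1)) f =
      expect (pathLaw P x T) fun w =>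
        expect (P (w (Fin.last T))) fun y => f (Fin.snoc (α := fun _ => S) w y) := by
  rw [pathLaw, expect_bind]
  simp only [expect_map]

theorem forall_snoc {S : Type} {T : ℕ} (w : Fin (T + 1) → S) (y : S) (p : S → Prop) :
    (∀ t, p (Fin.snoc (α := fun _ => S) w y t)) ↔ (∀ t, p (w t)) ∧ p y := by
  constructor
  · intro h
    refine ⟨fun t => ?_, ?_⟩
    · simpa using h t.castSucc
    · simpa using h (Fin.last _)
  · rintro ⟨h, hy⟩ t
    induction t using Fin.lastCases with
    | last => simpa using hy
    | cast t => simpa using h t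

variable {S : Type} (P : S → PMF S) (x : S) (A H : Set S)

open Classical in
/-- A function that contracts in expectation as long as the chain stays in `H` decays
geometrically on the paths inside `H`. -/
theorem expect_stay_le (F : S → ENNReal) (r : ENNReal)
    (hF : ∀ x ∈ H, expect (P x) (H.indicator F) ≤ r * F x) (hx : x ∈ H) (T : ℕ) :
    expect (pathLaw P x T) (fun w => if ∀ t, w t ∈ H then F (w (Fin.last T)) else 0)
      ≤ r ^ T * F x := by
  induction T with
  | zero => simp [pathLaw, expect_pure, hx]
  | succ T ih =>
    rw [expect_pathLaw_succ]
    calc _ ≤ expect (pathLaw P x T)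
          (fun w => r * if ∀ t, w t ∈ H then F (w (Fin.last T)) else 0) := by
          apply expect_mono
          intro w
          simp only [forall_snoc w _ (· ∈ H), Fin.snoc_last]
          by_cases hw : ∀ t, w t ∈ H
          · simpa +unfoldPartialApp [hw, Set.indicator] using hF _ (hw (Fin.last T))
          · simp [hw, expect_const]
      _ ≤ r * (r ^ T * F x) := by
          rw [expect_const_mul]
          gcongr
      _ = _ := by ring

open Classical in
/-- A chain that leaves `H` outside `A` with probability at most `ε` per round does so within
`T` rounds with probability at most `T * ε`. -/
theorem expect_escape_le (ε : ENNReal)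
    (hε : ∀ x ∈ H, expect (P x) ((H ∪ A)ᶜ.indicator fun _ => 1) ≤ ε) (hx : x ∈ H) (T : ℕ) :
    expect (pathLaw P x T) (fun w => if (∀ t, w t ∉ A) ∧ ¬ ∀ t, w t ∈ H then 1 else 0)
      ≤ T * ε := by
  induction T with
  | zero => simp [pathLaw, expect_pure, hx]
  | succ T ih =>
    rw [expect_pathLaw_succ]
    calc _ ≤ expect (pathLaw P x T)
          (fun w => (if (∀ t, w t ∉ A) ∧ ¬ ∀ t, w t ∈ H then 1 else 0) + ε) := by
          apply expect_mono
          intro w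
          simp only [forall_snoc w _ (· ∈ H), forall_snoc w _ (· ∉ A)]
          -- Either the exit happens in this very round, at cost `ε`, or the path had already left
          -- `H` and is counted by the first summand.
          by_cases hw : ∀ t, w t ∈ H
          · refine le_trans (expect_mono _ fun y => ?_)
              ((hε _ (hw (Fin.last T))).trans le_add_self)
            by_cases hy : y ∈ H <;> by_cases hA : y ∈ A <;> simp [hw, hy, hA]
            split_ifs <;> simp
          · refine le_trans (expect_mono (g := fun _ => if ∀ t, w t ∉ A then 1 else 0) _ fun y => ?_) ?_
            · by_cases hA : ∀ t, w t ∉ A <;> simp only [hw, hA]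
              · simp
                split_ifs <;> simp
              · simp
            · rw [expect_const]
              simp [hw]
      _ ≤ T * ε + ε := by
          rw [expect_add, expect_const]
          gcongr
      _ = _ := by push_cast; ring

/-- A path avoiding `A` either stays in `H` throughout, which Markov's inequality for `F` controls
since `c * F ≥ 1` on `H`, or leaves `H` at some round without entering `A`. -/
theorem avoid_le (F : S → ENNReal) (r ε c : ENNReal)
    (hF : ∀ x ∈ H, expect (P x) (H.indicator F) ≤ r * F x)
    (hε : ∀ x ∈ H, expect (P x) ((H ∪ A)ᶜ.indicator fun _ => 1) ≤ ε)
    (hc : ∀ x ∈ H, 1 ≤ c * F x) (hx : x ∈ H) (T : ℕ) :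
    (pathLaw P x T).toOuterMeasure {w | ∃ t, w t ∈ A}ᶜ ≤ c * (r ^ T * F x) + T * ε := by
  classical
  rw [toOuterMeasure_eq_expect]
  refine le_trans ?_ (add_le_add (mul_le_mul_right (expect_stay_le P x H F r hF hx T) c)
    (expect_escape_le P x A H ε hε hx T))
  rw [← expect_const_mul, ← expect_add]
  apply expect_mono
  intro w
  by_cases hA : ∀ t, w t ∉ A
  · by_cases hw : ∀ t, w t ∈ H
    · simpa [Set.indicator, hA, hw] using hc _ (hw (Fin.last T))
    · simp [Set.indicator, hA, hw]
  · have : w ∉ {w | ∃ t, w t ∈ A}ᶜ := by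
      simpa using hA
    simp [this]

theorem one_sub_le_hitProb (T : ℕ) (δ : ℝ) (hδ : 0 ≤ δ)
    (h : (pathLaw P x T).toOuterMeasure {w | ∃ t, w t ∈ A}ᶜ ≤ ENNReal.ofReal δ) :
    1 - δ ≤ hitProb P x A T := by
  set p := pathLaw P x T
  set E := {w : Fin (T + 1) → S | ∃ t, w t ∈ A}
  have h1 : 1 ≤ p.toOuterMeasure E + p.toOuterMeasure Eᶜ := by
    rw [toOuterMeasure_eq_expect, toOuterMeasure_eq_expect, ← expect_add]
    refine (expect_const p 1).symm.le.trans ?_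
    apply expect_mono
    intro w
    by_cases hw : w ∈ E <;> simp [hw]
  have hfin : p.toOuterMeasure E ≠ ⊤ := by
    refine ne_top_of_le_ne_top ENNReal.one_ne_top ?_
    rw [toOuterMeasure_eq_expect]
    refine le_trans (expect_mono p (g := fun _ => 1) fun w => ?_) (expect_const p 1).le
    by_cases hw : w ∈ E <;> simp [hw]
  have h2 : 1 ≤ p.toOuterMeasure E + ENNReal.ofReal δ := h1.trans (by gcongr)
  have h3 := ENNReal.toReal_mono (by simp [hfin]) h2
  rw [ENNReal.toReal_add hfin ENNReal.ofReal_ne_top, ENNReal.toReal_ofReal hδ] at h3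
  simp only [ENNReal.toReal_one] at h3
  unfold hitProb
  linarith

end UndecidedState

/-! ### One round of the U-Process: exponential moments and characteristic function of the bias. -/

namespace UndecidedState
variable {n : ℕ}

/-- The contribution of a node to the bias. -/
def Opinion.val : Opinion → ℤ
  | .alpha => 1
  | .beta => -1
  | .undecided => 0

theorem Opinion.abs_val_le (o : Opinion) : |(o.val : ℝ)| ≤ 1 := by
  cases o <;> simp [Opinion.val]

theorem Config.card_node (x : Config n) : Fintype.card x.Node = n := by
  have := x.sum_eq
  simp only [Fintype.card_sum, Fintype.card_fin]
  omega

theorem Config.sum_opinion {M : Type} [Semiring M] (x : Config n) (h : Opinion → M) :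
    ∑ u, h (x.opinion u) = x.a * h .alpha + x.b * h .beta + x.q * h .undecided := by
  simp [Fintype.sum_sum_type, Config.opinion, add_assoc]

theorem Config.prod_opinion {M : Type} [CommMonoid M] (x : Config n) (h : Opinion → M) :
    ∏ u, h (x.opinion u) = h .alpha ^ x.a * h .beta ^ x.b * h .undecided ^ x.q := by
  simp [Fintype.prod_sum_type, Config.opinion, mul_assoc]

theorem Config.bias_next (x : Config n) (g : x.Node → x.Node) :
    (x.next g).bias = ∑ u, (x.newOpinion g u).val := by
  classical
  simp only [Config.bias, Config.next, Nat.card_eq_fintype_card, Fintype.card_subtype,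
    Finset.card_filter]
  push_cast
  rw [← Finset.sum_sub_distrib]
  refine Finset.sum_congr rfl fun u _ => ?_
  cases x.newOpinion g u <;> simp [Opinion.val]

/-- Independence of the choices: expanding the product over nodes gives one term for each choice
function. -/
theorem Config.sum_prod_newOpinion {M : Type} [CommSemiring M] (x : Config n) (h : Opinion → M) :
    ∑ g, ∏ u, h (x.newOpinion g u) =
      ∏ u, ∑ v, h ((x.opinion u).update (x.opinion v)) := by
  classical
  rw [Finset.prod_univ_sum, Fintype.piFinset_univ]
  rfl

/-- The expected value of `f` after a round of the U-Process. -/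
noncomputable def Config.mean (x : Config n) (f : Config n → ℝ) : ℝ :=
  (∑ g, f (x.next g)) / (n : ℝ) ^ n

theorem Config.mean_mono (x : Config n) {f h : Config n → ℝ} (H : ∀ y, f y ≤ h y) :
    x.mean f ≤ x.mean h := by
  unfold Config.mean
  gcongr
  exact H _

theorem Config.mean_add (x : Config n) (f h : Config n → ℝ) :
    x.mean (fun y => f y + h y) = x.mean f + x.mean h := by
  simp [Config.mean, Finset.sum_add_distrib, add_div]

theorem Config.mean_const_mul (x : Config n) (c : ℝ) (f : Config n → ℝ) :
    x.mean (fun y => c * f y) = c * x.mean f := by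
  simp [Config.mean, ← Finset.mul_sum, mul_div_assoc]

theorem Config.mean_const (x : Config n) (hn : 0 < n) (c : ℝ) : x.mean (fun _ => c) = c := by
  have h : (0 : ℝ) < (n : ℝ) ^ n := by positivity
  simp only [Config.mean, Finset.sum_const, Finset.card_univ, Fintype.card_fun, x.card_node,
    nsmul_eq_mul]
  push_cast
  field_simp

theorem expect_uStep (hn : 0 < n) (x : Config n) (f : Config n → ℝ) (hf : ∀ y, 0 ≤ f y) :
    expect (uStep x) (fun y => ENNReal.ofReal (f y)) = ENNReal.ofReal (x.mean f) := by
  have h : (0 : ℝ) < (n : ℝ) ^ n := by positivity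
  rw [uStep, expect_map, expect, tsum_fintype, Config.mean, ENNReal.ofReal_div_of_pos h,
    ENNReal.ofReal_sum_of_nonneg fun _ _ => hf _]
  simp only [PMF.uniformOfFintype_apply, ← Finset.mul_sum]
  rw [Fintype.card_fun, x.card_node, ENNReal.div_eq_inv_mul]
  congr 2
  rw [ENNReal.ofReal_pow (by positivity), ENNReal.ofReal_natCast]
  push_cast
  rfl

/-- The expected contribution to the bias after a round of a node with opinion `o`. -/
noncomputable def Config.drift (x : Config n) (o : Opinion) : ℝ :=
  (∑ v, ((o.update (x.opinion v)).val : ℝ)) / n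

theorem Config.abs_drift_le (x : Config n) (o : Opinion) : |x.drift o| ≤ 1 := by
  unfold Config.drift
  rw [abs_div, Nat.abs_cast]
  refine div_le_one_of_le₀ ?_ (by positivity)
  refine (Finset.abs_sum_le_sum_abs _ _).trans ?_
  refine (Finset.sum_le_sum fun v _ => Opinion.abs_val_le _).trans ?_
  simp only [Finset.sum_const, Finset.card_univ, x.card_node, nsmul_eq_mul, mul_one, le_refl]

/-- Meetings of opposite colors cost each color ab/n in expectation and cancel; each undecided node
contributes s/n. -/
theorem Config.sum_drift (x : Config n) (hn : 0 < n) :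
    ∑ u, x.drift (x.opinion u) = x.bias * (1 + x.q / n) := by
  have hs : (n : ℝ) = x.a + x.b + x.q := by exact_mod_cast x.sum_eq.symm
  have hn' : (n : ℝ) ≠ 0 := by positivity
  rw [x.sum_opinion fun o => x.drift o]
  have hd : ∀ o, x.drift o = (x.a * ((o.update .alpha).val : ℝ) + x.b * ((o.update .beta).val : ℝ)
      + x.q * ((o.update .undecided).val : ℝ)) / n := fun o => by
    rw [Config.drift, x.sum_opinion fun p => ((o.update p).val : ℝ)]
  simp only [hd, Opinion.update, Opinion.val, Config.bias]
  push_cast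
  field_simp
  rw [hs]
  ring

theorem Config.sum_exp_update_le (x : Config n) (hn : 0 < n) (o : Opinion) (t : ℝ)
    (ht : |t| ≤ 1 / 2) :
    ∑ v, Real.exp (t * (o.update (x.opinion v)).val) ≤
      n * Real.exp (t * x.drift o + 4 * t ^ 2) := by
  have hn' : (n : ℝ) ≠ 0 := by positivity
  set μ := x.drift o with hμ
  have hμ1 := x.abs_drift_le o
  -- This is e^z ≤ 1 + z + z² for z = t(c - μ). As |c - μ| ≤ 2, the bound |t| ≤ 1/2 gives |z| ≤ 1
  -- and z² ≤ 4t². The linear term vanishes on summation over v.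
  have key : ∀ v, Real.exp (t * (o.update (x.opinion v)).val) ≤
      Real.exp (t * μ) * (1 + t * (o.update (x.opinion v)).val - t * μ + 4 * t ^ 2) := by
    intro v
    set c : ℝ := ((o.update (x.opinion v)).val : ℝ)
    have hc : |c| ≤ 1 := Opinion.abs_val_le _
    have hd : |c - μ| ≤ 2 := (abs_sub _ _).trans (by linarith)
    have h1 : |t * (c - μ)| ≤ 1 := by
      rw [abs_mul]
      nlinarith [abs_nonneg t, abs_nonneg (c - μ)]
    have h2 := (abs_le.1 (Real.abs_exp_sub_one_sub_id_le h1)).2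
    have h3 : (t * (c - μ)) ^ 2 ≤ 4 * t ^ 2 := by
      rw [mul_pow]
      have : (c - μ) ^ 2 ≤ 4 := by
        rw [← sq_abs]
        nlinarith [abs_nonneg (c - μ)]
      nlinarith [sq_nonneg t]
    have h4 : t * c = t * μ + t * (c - μ) := by ring
    rw [h4, Real.exp_add]
    gcongr
    linarith
  refine (Finset.sum_le_sum fun v _ => key v).trans ?_
  rw [← Finset.mul_sum]
  have hsum : ∑ v, (1 + t * ((o.update (x.opinion v)).val : ℝ) - t * μ + 4 * t ^ 2) =
      n * (1 + 4 * t ^ 2) := by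
    simp only [Finset.sum_add_distrib, Finset.sum_sub_distrib, ← Finset.mul_sum]
    have : ∑ v, ((o.update (x.opinion v)).val : ℝ) = n * μ := by
      rw [hμ, Config.drift]
      field_simp
    rw [this]
    simp only [Finset.sum_const, Finset.card_univ, x.card_node, nsmul_eq_mul]
    ring
  rw [hsum, Real.exp_add]
  have := Real.add_one_le_exp (4 * t ^ 2)
  calc _ = n * (Real.exp (t * μ) * (4 * t ^ 2 + 1)) := by ring
    _ ≤ _ := by gcongr

theorem Config.mean_exp_le (x : Config n) (hn : 0 < n) (t : ℝ) (ht : |t| ≤ 1 / 2) :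
    x.mean (fun y => Real.exp (t * y.bias)) ≤
      Real.exp (t * (x.bias * (1 + x.q / n)) + 4 * n * t ^ 2) := by
  have h : (0 : ℝ) < (n : ℝ) ^ n := by positivity
  rw [Config.mean, div_le_iff₀ h]
  have h1 : ∀ g, Real.exp (t * (x.next g).bias) =
      ∏ u, Real.exp (t * (x.newOpinion g u).val) := by
    intro g
    rw [← Real.exp_sum, x.bias_next, ← Finset.mul_sum]
    push_cast
    rfl
  simp only [h1]
  rw [x.sum_prod_newOpinion fun o => Real.exp (t * o.val)]
  refine (Finset.prod_le_prod (fun u _ => Finset.sum_nonneg fun v _ => (Real.exp_pos _).le)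
    fun u _ => x.sum_exp_update_le hn _ t ht).trans ?_
  rw [Finset.prod_mul_distrib, ← Real.exp_sum, Finset.sum_add_distrib, ← Finset.mul_sum,
    x.sum_drift hn]
  simp only [Finset.prod_const, Finset.sum_const, Finset.card_univ, x.card_node, nsmul_eq_mul]
  rw [mul_comm]
  apply le_of_eq
  ring_nf

/-- Anti-concentration: the characteristic function of the bias after a round is bounded away
from `1` as long as the present bias is small. -/
theorem Config.mean_cos_le (x : Config n) (hn : 0 < n) (hx : x.InRange)
    (hs : |(x.bias : ℝ)| ≤ 1 / 20 * √n) :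
    x.mean (fun y => Real.cos (y.bias / √n)) ≤ Real.exp (-(1 / 360)) := by
  have hN : (0 : ℝ) < n := by exact_mod_cast hn
  have h : (0 : ℝ) < (n : ℝ) ^ n := by positivity
  have hr : (0 : ℝ) < √n := by positivity
  have hr2 : √(n : ℝ) * √n = n := Real.mul_self_sqrt hN.le
  have hr1 : 1 ≤ √(n : ℝ) := Real.one_le_sqrt.2 (by exact_mod_cast hn)
  have hsum : (n : ℝ) = x.a + x.b + x.q := by exact_mod_cast x.sum_eq.symm
  obtain ⟨hq1, hq2⟩ := hx
  set t : ℝ := 1 / √n with ht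
  have ht0 : 0 < t := by positivity
  have htt : t ^ 2 = 1 / n := by rw [ht, div_pow, sq √(n : ℝ), hr2, one_pow]
  have ht1 : t ≤ 1 := by rw [ht]; exact div_le_one_of_le₀ hr1 hr.le
  set φ : Opinion → ℂ := fun o => ∑ v, Complex.exp ((t * (o.update (x.opinion v)).val : ℝ) * Complex.I)
    with hφ
  have hφ1 : ∀ o, ‖φ o‖ ≤ n := by
    intro o
    refine (norm_sum_le _ _).trans ?_
    simp only [Complex.norm_exp_ofReal_mul_I, Finset.sum_const, Finset.card_univ, x.card_node,
      nsmul_eq_mul, mul_one, le_refl]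
  -- At least n/2 colored nodes each lower the real part by 1/(5n), so it is at most n - 1/10; the
  -- small bias keeps the imaginary part below 1/20.
  have hφu : ‖φ .undecided‖ ≤ n * Real.exp (-(1 / 20) / n) := by
    have hval : φ .undecided = x.a * Complex.exp ((t : ℝ) * Complex.I)
        + x.b * Complex.exp ((-t : ℝ) * Complex.I) + x.q := by
      rw [hφ]
      simp only
      rw [x.sum_opinion fun o => Complex.exp ((t * (Opinion.undecided.update o).val : ℝ) * Complex.I)]
      simp [Opinion.update, Opinion.val]
    have hre : (φ .undecided).re = (x.a + x.b) * Real.cos t + x.q := by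
      rw [hval]
      simp only [Complex.add_re, Complex.mul_re, Complex.natCast_re, Complex.natCast_im,
        Complex.exp_ofReal_mul_I_re, Real.cos_neg]
      ring
    have him : (φ .undecided).im = x.bias * Real.sin t := by
      rw [hval]
      simp only [Complex.add_im, Complex.mul_im, Complex.natCast_re, Complex.natCast_im,
        Complex.exp_ofReal_mul_I_im, Real.sin_neg, Config.bias]
      push_cast
      ring
    have hcos : Real.cos t ≤ 1 - 1 / 5 * (1 / n) := by
      have h1 := (abs_le.1 (Real.cos_bound (abs_le.2 ⟨by linarith, ht1⟩))).2
      rw [abs_of_pos ht0] at h1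
      have h2 : t ^ 4 ≤ t ^ 2 := pow_le_pow_of_le_one ht0.le ht1 (by norm_num)
      rw [← htt]
      linarith [sq_nonneg t]
    have hcos0 : 0 ≤ Real.cos t := Real.cos_nonneg_of_mem_Icc
      ⟨by linarith [Real.pi_gt_three], by linarith [Real.pi_gt_three]⟩
    have hb1 : |(φ .undecided).re| ≤ n - 1 / 10 := by
      rw [hre, abs_of_nonneg (by positivity)]
      have : (n : ℝ) / 2 ≤ x.a + x.b := by linarith
      have h5 : 1 / 10 ≤ ((x.a : ℝ) + x.b) * (1 / 5 * (1 / n)) := by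
        have : 1 / 10 = (n : ℝ) / 2 * (1 / 5 * (1 / n)) := by field_simp; norm_num
        rw [this]
        gcongr
      nlinarith
    have hb2 : |(φ .undecided).im| ≤ 1 / 20 := by
      rw [him, abs_mul]
      calc |(x.bias : ℝ)| * |Real.sin t| ≤ (1 / 20 * √n) * |t| := by
            exact mul_le_mul hs Real.abs_sin_le_abs (abs_nonneg _) (by positivity)
        _ = 1 / 20 := by
            rw [abs_of_pos ht0, ht]
            field_simp
    refine (Complex.norm_le_abs_re_add_abs_im _).trans ?_
    have := Real.add_one_le_exp (-(1 / 20) / (n : ℝ))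
    calc _ ≤ n * (-(1 / 20) / (n : ℝ) + 1) := by
          field_simp
          linarith
      _ ≤ _ := by gcongr
  -- Colored nodes get the trivial bound; the at least n/18 undecided ones give the exponent 1/20 ·
  -- 1/18 = 1/360.
  have hprod : ‖∏ u, φ (x.opinion u)‖ ≤ (n : ℝ) ^ n * Real.exp (-(1 / 360)) := by
    rw [x.prod_opinion, norm_mul, norm_mul, norm_pow, norm_pow, norm_pow]
    calc _ ≤ (n : ℝ) ^ x.a * (n : ℝ) ^ x.b * (n * Real.exp (-(1 / 20) / n)) ^ x.q := by
          gcongr <;> apply hφ1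
      _ = (n : ℝ) ^ n * Real.exp (x.q * (-(1 / 20) / n)) := by
          have hpow : (n : ℝ) ^ n = (n : ℝ) ^ x.a * (n : ℝ) ^ x.b * (n : ℝ) ^ x.q := by
            rw [← pow_add, ← pow_add, x.sum_eq]
          rw [Real.exp_nat_mul, hpow, mul_pow]
          ring
      _ ≤ _ := by
          gcongr
          have : (1 : ℝ) / 18 ≤ x.q / n := by
            rw [le_div_iff₀ hN]
            linarith
          have h7 : (x.q : ℝ) * (-(1 / 20) / n) = -(1 / 20) * (x.q / n) := by ring
          rw [h7]
          linarith
  rw [Config.mean, div_le_iff₀ h, mul_comm]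
  refine le_trans ?_ hprod
  have hexp : ∏ u, φ (x.opinion u) = ∑ g, Complex.exp (((x.next g).bias / √n : ℝ) * Complex.I) := by
    rw [hφ]
    rw [← x.sum_prod_newOpinion fun o => Complex.exp ((t * o.val : ℝ) * Complex.I)]
    refine Finset.sum_congr rfl fun g _ => ?_
    rw [← Complex.exp_sum, x.bias_next, ← Finset.sum_mul, ← Complex.ofReal_sum, ← Finset.mul_sum]
    congr 3
    push_cast
    rw [ht]
    ring
  rw [hexp]
  refine le_trans (le_of_eq ?_) (Complex.re_le_norm _)
  simp only [Complex.re_sum, Complex.exp_ofReal_mul_I_re]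

end UndecidedState

/-! ### Contraction of the potential, and improbability of a huge jump. -/

namespace UndecidedState
variable {n : ℕ}

/-- The rate of the exponential potential. -/
noncomputable def rate : ℝ := 1 / 1000000

/-- A potential that decreases exponentially in the bias. -/
noncomputable def Config.potential (x : Config n) : ℝ :=
  Real.exp (-(rate * |(x.bias : ℝ)| / √n))

theorem Config.potential_pos (x : Config n) : 0 < x.potential := Real.exp_pos _

/-- Drift regime: replacing |s| by s times the sign of the present bias only increases the potential
and makes it a plain exponential moment. -/
theorem Config.mean_potential_le_of_large (x : Config n) (hn : 0 < n) (hx : x.InRange)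
    (hs : 144 * rate * √n ≤ |(x.bias : ℝ)|) :
    x.mean Config.potential ≤ Real.exp (-(4 * rate ^ 2)) * x.potential := by
  have hN : (0 : ℝ) < n := by exact_mod_cast hn
  have hr : 0 < √(n : ℝ) := by positivity
  have hr2 : √(n : ℝ) ^ 2 = n := Real.sq_sqrt hN.le
  have hr1 : 1 ≤ √(n : ℝ) := Real.one_le_sqrt.2 (by exact_mod_cast hn)
  have hL : 0 < rate := by norm_num [rate]
  have hL1 : rate ≤ 1 / 2 := by norm_num [rate]
  obtain ⟨σ, hσ, hσs⟩ : ∃ σ : ℝ, |σ| = 1 ∧ σ * x.bias = |(x.bias : ℝ)| := by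
    rcases abs_choice (x.bias : ℝ) with h | h
    · exact ⟨1, by simp, by rw [h, one_mul]⟩
    · exact ⟨-1, by simp, by rw [h]; ring⟩
  have ht : |-(σ * rate / √n)| ≤ 1 / 2 := by
    rw [abs_neg, abs_div, abs_mul, hσ, abs_of_pos hL, abs_of_pos hr, one_mul,
      div_le_iff₀ hr]
    nlinarith
  refine le_trans (x.mean_mono fun y => ?_) ((x.mean_exp_le hn _ ht).trans ?_)
  · apply Real.exp_le_exp.2
    have h1 : σ * y.bias ≤ |(y.bias : ℝ)| := by
      calc σ * y.bias ≤ |σ * y.bias| := le_abs_self _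
        _ = _ := by rw [abs_mul, hσ, one_mul]
    have h2 : rate * (σ * y.bias) / √n ≤ rate * |(y.bias : ℝ)| / √n := by gcongr
    calc _ ≤ -(rate * (σ * y.bias) / √n) := by linarith
      _ = _ := by ring
  · rw [Config.potential, ← Real.exp_add]
    apply Real.exp_le_exp.2
    have hσ2 : σ ^ 2 = 1 := by rw [← sq_abs, hσ, one_pow]
    have h3 : 4 * (n : ℝ) * (-(σ * rate / √n)) ^ 2 = 4 * rate ^ 2 := by
      rw [neg_sq, div_pow, mul_pow, hσ2, hr2]
      field_simp
    have h4 : -(σ * rate / √n) * (x.bias * (1 + x.q / n)) =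
        -(rate * |(x.bias : ℝ)| / √n) - rate * (|(x.bias : ℝ)| / √n) * (x.q / n) := by
      rw [← hσs]
      ring
    have h5 : 144 * rate ≤ |(x.bias : ℝ)| / √n := by rwa [le_div_iff₀ hr]
    have h6 : (1 : ℝ) / 18 ≤ x.q / n := by
      rw [le_div_iff₀ hN]
      linarith [hx.1]
    -- The drift gains 144/18 = 8 times `rate ^ 2`; the variance term takes 4 of these and 4 remain.
    have h7 : rate * (144 * rate) * (1 / 18) ≤ rate * (|(x.bias : ℝ)| / √n) * (x.q / n) := by
      gcongr
    rw [h3, h4]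
    linarith

/-- Fluctuation regime: the potential lies below an affine function of the cosine, whose mean is
bounded by anti-concentration. -/
theorem Config.mean_potential_le_of_small (x : Config n) (hn : 0 < n) (hx : x.InRange)
    (hs : |(x.bias : ℝ)| ≤ 144 * rate * √n) :
    x.mean Config.potential ≤ Real.exp (-(4 * rate ^ 2)) * x.potential := by
  have hN : (0 : ℝ) < n := by exact_mod_cast hn
  have hr : 0 < √(n : ℝ) := by positivity
  have hL : 0 < rate := by norm_num [rate]
  have hcos : x.mean (fun y => Real.cos (y.bias / √n)) ≤ Real.exp (-(1 / 360)) := by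
    refine x.mean_cos_le hn hx (hs.trans ?_)
    gcongr
    norm_num [rate]
  -- With v = min(|u|, 1), combine exp(-rate·v) ≤ 1 - rate·v/2 and 1 - cos u ≤ 2v.
  have hpt : ∀ y : Config n, y.potential ≤
      (1 - rate / 4) + rate / 4 * Real.cos (y.bias / √n) := by
    intro y
    set u : ℝ := y.bias / √n with hu
    have h1 : y.potential = Real.exp (-(rate * |u|)) := by
      rw [Config.potential, hu, abs_div, abs_of_pos hr, mul_div_assoc]
    rw [h1]
    have hc1 : 1 - Real.cos u ≤ 2 * |u| := by
      have h2 := Real.one_sub_sq_div_two_le_cos (x := u)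
      rcases le_total |u| 1 with h | h
      · rw [← sq_abs] at h2
        nlinarith [abs_nonneg u]
      · linarith [Real.neg_one_le_cos u]
    have hc2 : 1 - Real.cos u ≤ 2 := by linarith [Real.neg_one_le_cos u]
    set v := min |u| 1 with hv
    have hv0 : 0 ≤ v := le_min (abs_nonneg _) zero_le_one
    have hv1 : v ≤ 1 := min_le_right _ _
    have hcv : 1 - Real.cos u ≤ 2 * v := by
      rcases le_total |u| 1 with h | h
      · rwa [hv, min_eq_left h]
      · rw [hv, min_eq_right h]
        linarith
    have hexp : Real.exp (-(rate * |u|)) ≤ Real.exp (-(rate * v)) := by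
      apply Real.exp_le_exp.2
      have : rate * v ≤ rate * |u| := by
        gcongr
        exact min_le_left _ _
      linarith
    have hrv : rate * v ≤ 1 / 2 := by
      have : rate ≤ 1 / 2 := by norm_num [rate]
      nlinarith
    have h3 : |-(rate * v)| ≤ 1 := by
      rw [abs_neg, abs_of_nonneg (by positivity)]
      linarith
    have h4 := (abs_le.1 (Real.abs_exp_sub_one_sub_id_le h3)).2
    have h5 : 0 ≤ rate * v := by positivity
    have h6 : rate * (1 - Real.cos u) ≤ rate * (2 * v) := by gcongr
    nlinarith
  refine (x.mean_mono hpt).trans ?_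
  rw [x.mean_add (fun _ => 1 - rate / 4) fun y => rate / 4 * Real.cos (y.bias / √n),
    x.mean_const_mul _ fun y => Real.cos (y.bias / √n), x.mean_const hn]
  have hE : Real.exp (-(1 / 360)) ≤ 1 - 1 / 361 := by
    rw [Real.exp_neg]
    have := Real.add_one_le_exp (1 / 360 : ℝ)
    refine (inv_anti₀ (by norm_num) this).trans (by norm_num)
  have hlow : 1 - 148 * rate ^ 2 ≤ Real.exp (-(4 * rate ^ 2)) * x.potential := by
    rw [Config.potential, ← Real.exp_add]
    refine le_trans ?_ (Real.add_one_le_exp _)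
    have h1 : rate * |(x.bias : ℝ)| / √n ≤ 144 * rate ^ 2 := by
      rw [div_le_iff₀ hr]
      calc _ ≤ rate * (144 * rate * √n) := by gcongr
        _ = _ := by ring
    linarith
  refine le_trans ?_ hlow
  have h2 : rate / 4 * x.mean (fun y => Real.cos (y.bias / √n)) ≤ rate / 4 * (1 - 1 / 361) := by
    gcongr
    exact hcos.trans hE
  -- Linear gain against quadratic loss, where 148 = 144 + 4: this is the condition that forces
  -- `rate` to be so small.
  have h3 : 148 * rate ^ 2 ≤ rate / 4 * (1 / 361) := by norm_num [rate]
  linarith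

theorem Config.mean_potential_le (x : Config n) (hn : 0 < n) (hx : x.InRange) :
    x.mean Config.potential ≤ Real.exp (-(4 * rate ^ 2)) * x.potential := by
  rcases le_total (144 * rate * √n) |(x.bias : ℝ)| with h | h
  · exact x.mean_potential_le_of_large hn hx h
  · exact x.mean_potential_le_of_small hn hx h

open Classical in
/-- A large bias does not arise from a small one in a single round. -/
theorem Config.mean_large_bias_le (x : Config n) (hn : 0 < n) (hx : x.InRange)
    (hs : |(x.bias : ℝ)| ≤ n / 12) :
    x.mean (fun y => if 2 / 3 * (n : ℝ) ≤ |(y.bias : ℝ)| then 1 else 0) ≤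
      2 * Real.exp (-(n / 72)) := by
  have hN : (0 : ℝ) < n := by exact_mod_cast hn
  -- Chernoff bound with tilt 1/12: the level 2n/3 costs n/18, while mean and variance return at
  -- most n/96 + n/36.
  have hb : ∀ t : ℝ, |t| = 1 / 12 → Real.exp (-(n / 18)) *
      x.mean (fun y => Real.exp (t * y.bias)) ≤ Real.exp (-(n / 72)) := by
    intro t ht
    calc _ ≤ Real.exp (-(n / 18)) *
          Real.exp (t * (x.bias * (1 + x.q / n)) + 4 * n * t ^ 2) := by
          gcongr
          exact x.mean_exp_le hn t (by rw [ht]; norm_num)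
      _ ≤ _ := by
          rw [← Real.exp_add]
          apply Real.exp_le_exp.2
          have h1 : t ^ 2 = 1 / 144 := by rw [← sq_abs, ht]; norm_num
          have h2 : (x.q : ℝ) / n ≤ 1 / 2 := by
            rw [div_le_iff₀ hN]
            linarith [hx.2]
          have h3 : t * (x.bias * (1 + x.q / n)) ≤ 1 / 12 * (n / 12 * (1 + 1 / 2)) := by
            refine (le_abs_self _).trans ?_
            rw [abs_mul, abs_mul, ht, abs_of_nonneg (a := 1 + (x.q : ℝ) / n) (by positivity)]
            gcongr
          rw [h1]
          linarith
  have hpt : ∀ y : Config n, (if 2 / 3 * (n : ℝ) ≤ |(y.bias : ℝ)| then (1 : ℝ) else 0) ≤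
      Real.exp (-(n / 18)) * Real.exp (1 / 12 * y.bias) +
      Real.exp (-(n / 18)) * Real.exp (-(1 / 12) * y.bias) := by
    intro y
    split_ifs with h
    · rw [← Real.exp_add, ← Real.exp_add]
      rcases le_abs.1 h with h | h
      · have : 1 ≤ Real.exp (-(n / 18) + 1 / 12 * y.bias) := Real.one_le_exp (by linarith)
        linarith [Real.exp_pos (-(n / 18) + -(1 / 12) * (y.bias : ℝ))]
      · have : 1 ≤ Real.exp (-(n / 18) + -(1 / 12) * y.bias) := Real.one_le_exp (by linarith)
        linarith [Real.exp_pos (-(n / 18) + 1 / 12 * (y.bias : ℝ))]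
    · positivity
  refine (x.mean_mono hpt).trans ?_
  rw [x.mean_add (fun y => Real.exp (-(n / 18)) * Real.exp (1 / 12 * y.bias))
      fun y => Real.exp (-(n / 18)) * Real.exp (-(1 / 12) * y.bias),
    x.mean_const_mul _ fun y => Real.exp (1 / 12 * y.bias),
    x.mean_const_mul _ fun y => Real.exp (-(1 / 12) * y.bias)]
  have h1 := hb (1 / 12) (by norm_num)
  have h2 := hb (-(1 / 12)) (by norm_num)
  linarith

/-! ### Transfer to the U-Pruned-Process. -/

theorem redirect_bias (y : Config n) : (redirect y).bias = y.bias := by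
  unfold redirect
  split_ifs
  · rfl
  · exact zConfig_bias _ _

/-- A bias below 2n/3 leaves more than n/3 nodes that may be undecided, and parity costs at most one
node from ⌊n/2⌋. -/
theorem redirect_inRange (hn : 18 ≤ n) (y : Config n) (hy : |(y.bias : ℝ)| < 2 / 3 * (n : ℝ)) :
    (redirect y).InRange := by
  unfold redirect
  split_ifs with h
  · exact h
  · have h1 : 3 * |y.bias| < 2 * n := by
      have : 3 * |(y.bias : ℝ)| < 2 * n := by linarith
      exact_mod_cast this
    rw [Int.abs_eq_natAbs] at h1
    have h2 := zConfig_q_le (by omega) y.bias y.natAbs_bias_le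
    have h3 : n ≤ 18 * (zConfig n y.bias y.natAbs_bias_le).q := by
      simp only [zConfig, zMinority]
      omega
    have h2' : 2 * ((zConfig n y.bias y.natAbs_bias_le).q : ℝ) ≤ n := by exact_mod_cast h2
    have h3' : (n : ℝ) ≤ 18 * ((zConfig n y.bias y.natAbs_bias_le).q : ℝ) := by exact_mod_cast h3
    exact ⟨by linarith, by linarith⟩

theorem redirect_mem (hn : 18 ≤ n) (m : ℝ) (y : Config n)
    (hy : |(y.bias : ℝ)| < 2 / 3 * (n : ℝ)) : redirect y ∈ H2 n m ∪ H4 n m := by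
  have h := redirect_inRange hn y hy
  rcases lt_or_ge |(y.bias : ℝ)| m with hm | hm
  · exact .inl ⟨h, by rwa [redirect_bias]⟩
  · exact .inr ⟨h.1, by rwa [redirect_bias], by rwa [redirect_bias]⟩

theorem expect_prunedStep_potential_le (hn : 0 < n) (m : ℝ) (x : Config n) (hx : x ∈ H2 n m) :
    expect (prunedStep m x) ((H2 n m).indicator fun y => ENNReal.ofReal y.potential) ≤
      ENNReal.ofReal (Real.exp (-(4 * rate ^ 2))) * ENNReal.ofReal x.potential := by
  rw [prunedStep, if_pos hx, expect_map, ← ENNReal.ofReal_mul (Real.exp_pos _).le]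
  refine (expect_mono _ (g := fun y => ENNReal.ofReal y.potential) fun y => ?_).trans ?_
  · refine (Set.indicator_le_self _ _ _).trans ?_
    simp only [Config.potential, redirect_bias, le_refl]
  · rw [expect_uStep hn x _ fun y => y.potential_pos.le]
    exact ENNReal.ofReal_le_ofReal (x.mean_potential_le hn hx.1)

theorem expect_prunedStep_escape_le (hn : 18 ≤ n) (m : ℝ) (hm : m ≤ n / 12) (x : Config n)
    (hx : x ∈ H2 n m) :
    expect (prunedStep m x) ((H2 n m ∪ H4 n m)ᶜ.indicator fun _ => 1) ≤
      ENNReal.ofReal (2 * Real.exp (-(n / 72))) := by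
  classical
  rw [prunedStep, if_pos hx, expect_map]
  refine (expect_mono _ (g := fun y => ENNReal.ofReal
    (if 2 / 3 * (n : ℝ) ≤ |(y.bias : ℝ)| then 1 else 0)) fun y => ?_).trans ?_
  · split_ifs with h
    · simpa using Set.indicator_le_self (H2 n m ∪ H4 n m)ᶜ (fun _ => (1 : ENNReal)) (redirect y)
    · rw [Set.indicator_of_notMem]
      · exact zero_le
      · exact fun hc => hc (redirect_mem hn m y (not_le.1 h))
  · rw [expect_uStep (by omega) x _ fun y => by split_ifs <;> norm_num]
    exact ENNReal.ofReal_le_ofReal (x.mean_large_bias_le (by omega) hx.1 (hx.2.le.trans hm))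

theorem le_hitProb_prunedStep (hn : 18 ≤ n) (m : ℝ) (hm : m ≤ n / 12) (x : Config n)
    (hx : x ∈ H2 n m) (T : ℕ) :
    1 - (Real.exp (rate * m / √n - 4 * rate ^ 2 * T) + T * (2 * Real.exp (-(n / 72)))) ≤
      hitProb (prunedStep m) x (H4 n m) T := by
  have hL : 0 < rate := by norm_num [rate]
  apply one_sub_le_hitProb
  · positivity
  refine (avoid_le (prunedStep m) x (H4 n m) (H2 n m) (fun y => ENNReal.ofReal y.potential)
    (ENNReal.ofReal (Real.exp (-(4 * rate ^ 2)))) (ENNReal.ofReal (2 * Real.exp (-(n / 72))))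
    (ENNReal.ofReal (Real.exp (rate * m / √n)))
    (expect_prunedStep_potential_le (by omega) m) (expect_prunedStep_escape_le hn m hm)
    (fun y hy => ?_) hx T).trans ?_
  · rw [← ENNReal.ofReal_mul (Real.exp_pos _).le, ← ENNReal.ofReal_one]
    apply ENNReal.ofReal_le_ofReal
    rw [Config.potential, ← Real.exp_add]
    apply Real.one_le_exp
    have : rate * |(y.bias : ℝ)| / √n ≤ rate * m / √n := by
      gcongr
      exact hy.2.le
    linarith
  · rw [ENNReal.ofReal_add (Real.exp_pos _).le (by positivity)]
    have h1 : x.potential ≤ 1 := by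
      apply Real.exp_le_one_iff.2
      have : 0 ≤ rate * |(x.bias : ℝ)| / √n := by positivity
      linarith
    gcongr
    · rw [← ENNReal.ofReal_pow (Real.exp_pos _).le, ← ENNReal.ofReal_mul (by positivity),
        ← ENNReal.ofReal_mul (by positivity)]
      apply ENNReal.ofReal_le_ofReal
      rw [← Real.exp_nat_mul, sub_eq_add_neg, Real.exp_add]
      gcongr
      calc _ ≤ Real.exp (T * -(4 * rate ^ 2)) * 1 := by gcongr
        _ = _ := by
          rw [mul_one]
          ring_nf
    · rw [ENNReal.ofReal_mul (p := (T : ℝ)) (by positivity), ENNReal.ofReal_natCast]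

end UndecidedState

/-! ### Choice of the constants. -/

open UndecidedState in
theorem mainTheorem4 (κ β : ℝ) (hκ : 0 < κ) (hβ : 0 < β) :
    ∃ C : ℝ, 0 < C ∧ ∃ N : ℕ, ∀ n : ℕ, N ≤ n →
      ∀ m : ℝ, 0 < m → m ≤ κ * Real.sqrt n * Real.log n →
        ∀ x ∈ UndecidedState.H2 n m,
          1 - (n : ℝ) ^ (-β) ≤
            UndecidedState.hitProb (UndecidedState.prunedStep m) x (UndecidedState.H4 n m)
              ⌊C * Real.log n⌋₊ := by
  have hL : 0 < rate := by norm_num [rate]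
  -- `rate * κ` offsets the initial factor exp(rate·m/√n) and β is the target exponent. The surplus
  -- 2 log n ≥ 2 pays for the floor (at most 1) and for a factor e⁻¹ ≤ 1/2, as each error term gets
  -- half of n^(-β).
  set C : ℝ := (rate * κ + β + 2) / (4 * rate ^ 2) with hC
  have hC0 : 0 < C := by positivity
  refine ⟨C, hC0, ?_⟩
  have e1 : ∀ᶠ n : ℕ in Filter.atTop, κ * √(n : ℝ) * Real.log n ≤ n / 12 := by
    have h := (isLittleO_log_rpow_atTop (r := 1 / 2) (by norm_num)).bound
      (show 0 < 1 / (12 * κ) by positivity)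
    filter_upwards [tendsto_natCast_atTop_atTop.eventually h] with n hn
    rw [← Real.sqrt_eq_rpow, Real.norm_of_nonneg (Real.sqrt_nonneg _)] at hn
    have hn' := (Real.le_norm_self _).trans hn
    calc _ ≤ κ * √(n : ℝ) * (1 / (12 * κ) * √(n : ℝ)) := by gcongr
      _ = √(n : ℝ) ^ 2 / 12 := by field_simp
      _ = _ := by rw [Real.sq_sqrt (Nat.cast_nonneg n)]
  have e2 : ∀ᶠ n : ℕ in Filter.atTop,
      C * Real.log n * (2 * Real.exp (-(n / 72))) ≤ 1 / 2 * (n : ℝ) ^ (-β) := by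
    -- The extra -1 in the exponent absorbs the number of rounds, through log n ≤ n.
    have h := (isLittleO_exp_neg_mul_rpow_atTop (a := 1 / 72) (by norm_num) (-β - 1)).bound
      (show 0 < 1 / (4 * C) by positivity)
    filter_upwards [tendsto_natCast_atTop_atTop.eventually h,
      Filter.eventually_gt_atTop 0] with n hn hn0
    have hn0' : (0 : ℝ) < n := by exact_mod_cast hn0
    rw [Real.norm_of_nonneg (Real.exp_pos _).le, Real.norm_of_nonneg (by positivity),
      Real.rpow_sub_one hn0'.ne'] at hn
    have h1 : -((n : ℝ) / 72) = -(1 / 72) * n := by ring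
    calc _ ≤ C * n * (2 * (1 / (4 * C) * ((n : ℝ) ^ (-β) / n))) := by
          rw [h1]
          gcongr
          exact Real.log_le_self hn0'.le
      _ = _ := by
          field_simp
          norm_num
  obtain ⟨N, hN⟩ := Filter.eventually_atTop.1 (e1.and (e2.and (Filter.eventually_ge_atTop 18)))
  refine ⟨N, fun n hn m hm hm' x hx => ?_⟩
  obtain ⟨h1, h2, h3⟩ := hN n hn
  refine le_trans ?_ (le_hitProb_prunedStep h3 m (hm'.trans h1) x hx _)
  have hn0 : (0 : ℝ) < n := by positivity
  have hlog : 1 ≤ Real.log n := by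
    rw [Real.le_log_iff_exp_le hn0]
    have : (18 : ℝ) ≤ n := by exact_mod_cast h3
    linarith [Real.exp_one_lt_d9]
  set T := ⌊C * Real.log n⌋₊ with hT
  have hT1 : (T : ℝ) ≤ C * Real.log n := Nat.floor_le (by positivity)
  have hT2 : C * Real.log n - 1 ≤ T := (Nat.sub_one_lt_floor _).le
  have hA : (T : ℝ) * (2 * Real.exp (-(n / 72))) ≤ 1 / 2 * (n : ℝ) ^ (-β) :=
    le_trans (by gcongr) h2
  have hB : Real.exp (rate * m / √n - 4 * rate ^ 2 * T) ≤ 1 / 2 * (n : ℝ) ^ (-β) := by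
    have hr : 0 < √(n : ℝ) := by positivity
    have i1 : rate * m / √n ≤ rate * κ * Real.log n := by
      rw [div_le_iff₀ hr]
      calc _ ≤ rate * (κ * √n * Real.log n) := by gcongr
        _ = _ := by ring
    have i2 : 4 * rate ^ 2 * (C * Real.log n - 1) ≤ 4 * rate ^ 2 * T := by gcongr
    have i3 : 4 * rate ^ 2 * (C * Real.log n) = (rate * κ + β + 2) * Real.log n := by
      rw [hC]
      field_simp
    have i4 : 4 * rate ^ 2 ≤ 1 := by norm_num [rate]
    have i5 : Real.exp (-1) ≤ 1 / 2 := by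
      rw [Real.exp_neg]
      refine (inv_anti₀ (by norm_num) (Real.add_one_le_exp (1 : ℝ))).trans (by norm_num)
    calc _ ≤ Real.exp (-1 + Real.log n * -β) := by
          apply Real.exp_le_exp.2
          linarith
      _ = Real.exp (-1) * (n : ℝ) ^ (-β) := by
          rw [Real.exp_add, Real.rpow_def_of_pos hn0]
      _ ≤ _ := by gcongr
  linarith
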